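/- Let $p\ge 0$ and let $P$ be a probability measure on $\mathbb R^p$ that has a strictly positive density with respect to Lebesgue measure. **Additive noise models.** A square-integrable, mean-zero random vector $X=(X_1,\dots,X_p)$ with law $P$ is said to follow an additive noise model with directed acyclic graph (DAG) $G$ on $\{1,\dots,p\}$ if there are measurable functions $f_j$ and mutually independent, square-integrable, mean-zero noise variables $\varepsilon_1,\dots,\varepsilon_p$ (with possibly different distributions and variances) such that, almost surely, $$X_j=f_j\big(X_{\mathrm{pa}_G(j)}\big)+\varepsilon_j\qquad(j=1,\dots,p).$$ The law $P$ is *causally minimal* for $G$ if it is not Markov with respect to any proper subgraph of $G$, where $P$ is *Markov* with respect to a DAG $H$ if under $P$ each $X_j$ is conditionally independent of its non-descendants in $H$ given its parents in $H$. **Weak majorization.** For $u\in\mathbb R^p$ let $u_{[1]}\ge\dots\ge u_{[p]}$ be its entries in descending order. Write $u\prec_w v$ if $\sum_{i\le k}u_{[i]}\le\sum_{i\le k}v_{[i]}$ for $k=1,\dots,p$, and call this strict if moreover $v\prec_w u$ fails. For a permutation $\rho$ of $\{1,\dots,p\}$ put $$y_\rho=\Big(\mathrm{var}(X_{\rho(1)}),\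 E[\mathrm{var}(X_{\rho(2)}\mid X_{\rho(1)})],\ \dots,\ E[\mathrm{var}(X_{\rho(p)}\mid X_{\rho(1)},\dots,X_{\rho(p-1)})]\Big),$$ which depends only on $P$ and $\rho$. A permutation $\rho$ is a topological ordering of $G$ if $\rho(k)$ is not an ancestor of $\rho(j)$ in $G$ whenever $j<k$. **Assumption 1 (for $G$ and $P$).** For some topological ordering $\rho_0$ of $G$, with $x=y_{\rho_0}$: $x\prec_w y_\rho$ for all permutations $\rho$ of $\{1,\dots,p\}$, and this is strict for every $\rho$ that is not a topological ordering of $G$. **Theorem.** Under Assumption 1 the DAG is uniquely identified from the joint distribution: suppose that $G$ and $G'$ are DAGs on $\{1,\dots,p\}$ such that, for each of them, $P$ is the law of a random vector following an additive noise model with that DAG (with possibly different functions and noise variables, on possibly different probability spaces), $P$ is causally minimal for that DAG, and Assumption 1 holds for that DAG and $P$. Then $G=G'$. -/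

import Mathlib

open MeasureTheory ProbabilityTheory

namespace MajorizedANM

/-- `a` is a (proper) ancestor of `b`: there is a directed path of positive length from `a` to `b`. -/
def IsAncestor {p : ℕ} (G : Digraph (Fin p)) (a b : Fin p) : Prop :=
  Relation.TransGen G.Adj a b

/-- A directed graph without directed cycles (loops included). -/
def IsDAG {p : ℕ} (G : Digraph (Fin p)) : Prop :=
  ∀ i, ¬ IsAncestor G i i

/-- The parents of the node `j`. -/
def parents {p : ℕ} (G : Digraph (Fin p)) (j : Fin p) : Set (Fin p) :=
  {i | G.Adj i j}

/-- The non-descendants of `j`, the node `j` itself being excluded. -/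
def nonDescendants {p : ℕ} (G : Digraph (Fin p)) (j : Fin p) : Set (Fin p) :=
  {i | i ≠ j ∧ ¬ IsAncestor G j i}

/-- The ordering `ρ 0, ρ 1, …` of the nodes is topological for `G`: no node is an ancestor of a
node that is listed before it. -/
def IsTopologicalOrdering {p : ℕ} (G : Digraph (Fin p)) (ρ : Equiv.Perm (Fin p)) : Prop :=
  ∀ a b : Fin p, a < b → ¬ IsAncestor G (ρ b) (ρ a)

/-- The random vector `X` (on the space `(Ω, μ)`) follows the additive noise model
`X j = f j (X restricted to the parents of j) + ε j` with DAG `G`: all variables are square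
integrable and centred, and the noise variables are mutually independent. -/
structure IsAdditiveNoiseModel {p : ℕ} {Ω : Type*} [MeasurableSpace Ω] (G : Digraph (Fin p))
    (f : (j : Fin p) → (parents G j → ℝ) → ℝ) (X ε : Ω → Fin p → ℝ) (μ : Measure Ω) : Prop where
  isDAG : IsDAG G
  measurable_f : ∀ j, Measurable (f j)
  memLp_X : ∀ j, MemLp (fun ω => X ω j) 2 μ
  memLp_noise : ∀ j, MemLp (fun ω => ε ω j) 2 μ
  mean_X : ∀ j, ∫ ω, X ω j ∂μ = 0
  mean_noise : ∀ j, ∫ ω, ε ω j ∂μ = 0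
  indep_noise : iIndepFun (fun (j : Fin p) (ω : Ω) => ε ω j) μ
  structural_eq : ∀ j, ∀ᵐ ω ∂μ, X ω j = f j ((parents G j).domRestrict (X ω)) + ε ω j

/-- The σ-algebra on `ℝᵖ` generated by the coordinates in `s`. -/
@[reducible]
def coordSigma {p : ℕ} (s : Set (Fin p)) : MeasurableSpace (Fin p → ℝ) :=
  MeasurableSpace.comap (fun x : Fin p → ℝ => s.domRestrict x) inferInstance

theorem coordSigma_le {p : ℕ} (s : Set (Fin p)) :
    coordSigma s ≤ (inferInstance : MeasurableSpace (Fin p → ℝ)) := by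
  apply Measurable.comap_le
  exact measurable_pi_lambda _ (fun i => measurable_pi_apply _)

/-- The (local) Markov property of the law `P` on `ℝᵖ` with respect to `G`: under `P`, every
coordinate is conditionally independent of its non-descendants given its parents. -/
def IsMarkov {p : ℕ} (G : Digraph (Fin p)) (P : Measure (Fin p → ℝ)) [IsFiniteMeasure P] : Prop :=
  ∀ j, CondIndepFun (coordSigma (parents G j)) (coordSigma_le (parents G j))
    (fun x : Fin p → ℝ => x j) (fun x : Fin p → ℝ => (nonDescendants G j).domRestrict x) P

/-- Causal minimality: `P` is not Markov with respect to any proper subgraph of `G`. -/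
def IsCausallyMinimal {p : ℕ} (G : Digraph (Fin p)) (P : Measure (Fin p → ℝ))
    [IsFiniteMeasure P] : Prop :=
  ∀ H : Digraph (Fin p), H < G → ¬ IsMarkov H P

/-- `P` has a strictly positive density with respect to Lebesgue measure on `ℝᵖ`. -/
def HasPositiveDensity {p : ℕ} (P : Measure (Fin p → ℝ)) : Prop :=
  ∃ d : (Fin p → ℝ) → ENNReal, Measurable d ∧ (∀ x, 0 < d x) ∧ P = volume.withDensity d

/-- The vector of expected conditional variances along the ordering `ρ`: its `k`-th entry is
`E[Var(X_{ρ k} | X_{ρ 0}, …, X_{ρ (k-1)})]` for a random vector `X` with law `P`. -/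
noncomputable def condVarVector {p : ℕ} (P : Measure (Fin p → ℝ)) (ρ : Equiv.Perm (Fin p)) :
    Fin p → ℝ :=
  fun k => ∫ x, condVar (coordSigma (ρ '' Set.Iio k)) (fun y : Fin p → ℝ => y (ρ k)) P x ∂P

/-- The entries of `x`, rearranged in descending order. -/
noncomputable def descending {p : ℕ} (x : Fin p → ℝ) : Fin p → ℝ :=
  fun i => x (Tuple.sort x i.rev)

/-- `y` weakly majorizes `x`: for every `k`, the sum of the `k` largest entries of `x` is at most
the sum of the `k` largest entries of `y`. -/
def WeaklyMajorizedBy {p : ℕ} (x y : Fin p → ℝ) : Prop :=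
  ∀ k : ℕ, k ≤ p → ∑ i : Fin p with i.val < k, descending x i
    ≤ ∑ i : Fin p with i.val < k, descending y i

/-- The weak majorization assumption on the law `P` for the graph `G`: the vector of expected
conditional variances along a topological ordering of `G` is weakly majorized by the one along any
ordering, strictly so if that ordering is not topological for `G`. -/
def MajorizationAssumption {p : ℕ} (G : Digraph (Fin p)) (P : Measure (Fin p → ℝ)) : Prop :=
  ∃ ρ₀ : Equiv.Perm (Fin p), IsTopologicalOrdering G ρ₀ ∧
    ∀ ρ : Equiv.Perm (Fin p),
      WeaklyMajorizedBy (condVarVector P ρ₀) (condVarVector P ρ) ∧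
      (¬ IsTopologicalOrdering G ρ →
        ¬ WeaklyMajorizedBy (condVarVector P ρ) (condVarVector P ρ₀))

end MajorizedANM

namespace MajorizedANM

open Set

variable {p : ℕ}

/-! The majorization assumptions serve only to give both graphs a common topological ordering. Along
it, the conditional mean of `X j` given its predecessors is a.e. both `f j` of the `G`-parents and
`f' j` of the `G'`-parents, so these two functions agree a.e. (`ae_eq_of_common_ordering`).

Since `P` and Lebesgue measure have the same null sets, a Fubini argument shows that such a function
depends only on the common parents (`exists_ae_eq_of_domRestrict_ae_eq`). Hence the same noise
drives a model on `G ⊓ G'`, `P` is Markov for that graph (`isMarkov_inf`), and minimality of `G` and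
of `G'` forces both to equal `G ⊓ G'`. -/

/-! ### Residuals and coordinate σ-algebras -/

/-- The residual of the `j`-th structural equation, as a function on the space of values. -/
def residual (G : Digraph (Fin p)) (f : (j : Fin p) → (parents G j → ℝ) → ℝ) (j : Fin p)
    (x : Fin p → ℝ) : ℝ :=
  x j - f j ((parents G j).domRestrict x)

theorem measurable_domRestrict (s : Set (Fin p)) :
    Measurable (fun x : Fin p → ℝ => s.domRestrict x) :=
  measurable_pi_lambda _ fun _ => measurable_pi_apply _

theorem measurable_residual {G : Digraph (Fin p)} {f : (j : Fin p) → (parents G j → ℝ) → ℝ}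
    (hf : ∀ j, Measurable (f j)) (j : Fin p) : Measurable (residual G f j) :=
  (measurable_pi_apply j).sub ((hf j).comp (measurable_domRestrict _))

theorem measurable_coordSigma_apply {s : Set (Fin p)} {i : Fin p} (hi : i ∈ s) :
    Measurable[coordSigma s] (fun x : Fin p → ℝ => x i) :=
  Measurable.comp (measurable_pi_apply (⟨i, hi⟩ : s))
    (comap_measurable fun x : Fin p → ℝ => s.domRestrict x)

theorem measurable_coordSigma_domRestrict {s t : Set (Fin p)} (h : t ⊆ s) :
    Measurable[coordSigma s] (fun x : Fin p → ℝ => t.domRestrict x) :=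
  @measurable_pi_lambda _ _ _ (coordSigma s) _ _ fun i => measurable_coordSigma_apply (h i.2)

theorem IsDAG.wellFounded {G : Digraph (Fin p)} (hG : IsDAG G) : WellFounded G.Adj := by
  have : Std.Irrefl (Relation.TransGen G.Adj) := ⟨hG⟩
  have h : WellFounded (Relation.TransGen G.Adj) :=
    Finite.wellFounded_of_trans_of_irrefl _
  exact Subrelation.wf (fun h => Relation.TransGen.single h) h

theorem IsDAG.mono {G H : Digraph (Fin p)} (hG : IsDAG G) (h : H ≤ G) : IsDAG H :=
  fun i hi => hG i (Relation.TransGen.mono (fun _ _ hab => h hab) _ _ hi)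

/-- Coordinates in an ancestrally closed set are functions of the residuals in that set. -/
theorem measurable_apply_iSup_comap_residual {G : Digraph (Fin p)}
    {f : (j : Fin p) → (parents G j → ℝ) → ℝ} (hG : IsDAG G) (hf : ∀ j, Measurable (f j))
    {A : Set (Fin p)} (hA : ∀ i ∈ A, parents G i ⊆ A) (i : Fin p) (hi : i ∈ A) :
    Measurable[⨆ a ∈ A, MeasurableSpace.comap (residual G f a) inferInstance]
      (fun x : Fin p → ℝ => x i) := by
  induction i using hG.wellFounded.induction with
  | _ i ih =>
    set m : MeasurableSpace (Fin p → ℝ) :=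
      ⨆ a ∈ A, MeasurableSpace.comap (residual G f a) inferInstance with hm
    have h1 : Measurable[m] (fun x : Fin p → ℝ => (parents G i).domRestrict x) :=
      measurable_pi_lambda _ fun a => ih a a.2 (hA i hi a.2)
    have h2 : Measurable[m] (residual G f i) :=
      (comap_measurable _).mono
        (le_iSup₂ (f := fun a _ => MeasurableSpace.comap (residual G f a) inferInstance) i hi)
        le_rfl
    have h3 : (fun x : Fin p → ℝ => x i)
        = fun x => f i ((parents G i).domRestrict x) + residual G f i x := by
      funext x; simp [residual]
    rw [h3]
    exact ((hf i).comp h1).add h2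

/-- The coordinates in a parent-closed set are functions of the residuals indexed by it, and those
are jointly independent of any residual outside. -/
theorem indep_residual_coordSigma {G : Digraph (Fin p)} {P : Measure (Fin p → ℝ)}
    {f : (j : Fin p) → (parents G j → ℝ) → ℝ} (hG : IsDAG G) (hf : ∀ j, Measurable (f j))
    (hind : iIndepFun (residual G f) P)
    {A : Set (Fin p)} (hA : ∀ i ∈ A, parents G i ⊆ A) {j : Fin p} (hj : j ∉ A) :
    Indep (MeasurableSpace.comap (residual G f j) inferInstance) (coordSigma A) P := by
  have h := indep_iSup_of_disjoint (fun i => (measurable_residual hf i).comap_le)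
    hind.iIndep (S := {j}) (T := A) (by simpa using hj)
  simp only [mem_singleton_iff, iSup_iSup_eq_left] at h
  refine indep_of_indep_of_le_right h ?_
  rw [coordSigma, ← measurable_iff_comap_le]
  exact @measurable_pi_lambda _ _ _ (_) _ _ fun i => measurable_apply_iSup_comap_residual hG hf hA i i.2

/-! ### Independent residuals imply the Markov property -/

/-- Conditional law of `φ W + e` given `W`, for `e` independent of `W`. -/
theorem condDistrib_add_of_indepFun {Ω γ : Type*} [MeasurableSpace Ω] [MeasurableSpace γ]
    {μ : Measure Ω} [IsProbabilityMeasure μ] {W : Ω → γ} {e : Ω → ℝ} {φ : γ → ℝ}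
    (hW : Measurable W) (he : Measurable e) (hφ : Measurable φ) (h : IndepFun e W μ) :
    condDistrib (fun ω => φ (W ω) + e ω) W μ =ᵐ[μ.map W]
      ((Kernel.id ×ₖ Kernel.const γ (μ.map e)).map fun q : γ × ℝ => φ q.1 + q.2) := by
  have : IsProbabilityMeasure (μ.map e) := Measure.isProbabilityMeasure_map he.aemeasurable
  have hadd : Measurable fun q : γ × ℝ => φ q.1 + q.2 := by fun_prop
  have : IsMarkovKernel
      ((Kernel.id ×ₖ Kernel.const γ (μ.map e)).map fun q : γ × ℝ => φ q.1 + q.2) :=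
    Kernel.IsMarkovKernel.map _ hadd
  rw [condDistrib_ae_eq_iff_measure_eq_compProd (μ := μ) _ (by fun_prop)]
  have hprod := (indepFun_iff_map_prod_eq_prod_map_map hW.aemeasurable he.aemeasurable).1 h.symm
  have hT : Measurable fun q : γ × ℝ => (q.1, φ q.1 + q.2) := by fun_prop
  have h1 : μ.map (fun ω => (W ω, φ (W ω) + e ω))
      = ((μ.map W).prod (μ.map e)).map fun q : γ × ℝ => (q.1, φ q.1 + q.2) := by
    rw [← hprod, Measure.map_map hT (hW.prodMk he)]
    rfl
  rw [h1]
  ext s hs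
  rw [Measure.map_apply hT hs, Measure.prod_apply (hT hs), Measure.compProd_apply hs]
  refine lintegral_congr fun w => ?_
  rw [Kernel.map_apply' _ hadd _ (measurable_prodMk_left hs), Kernel.prod_apply,
    Kernel.id_apply, Kernel.const_apply, Measure.dirac_prod,
    Measure.map_apply measurable_prodMk_left (hadd (measurable_prodMk_left hs))]
  rfl

/-- Given `(K, L) = (k, l)`, the sum has the law of `φ k + e`, which does not involve `l`. -/
theorem condIndepFun_add_of_indepFun {Ω γ δ : Type*} [MeasurableSpace Ω] [StandardBorelSpace Ω]
    [MeasurableSpace γ] [MeasurableSpace δ] [StandardBorelSpace δ] [Nonempty δ]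
    {μ : Measure Ω} [IsProbabilityMeasure μ] {K : Ω → γ} {L : Ω → δ} {e : Ω → ℝ} {φ : γ → ℝ}
    (hK : Measurable K) (hL : Measurable L) (he : Measurable e) (hφ : Measurable φ)
    (h : IndepFun e (fun ω => (K ω, L ω)) μ) :
    (fun ω => φ (K ω) + e ω) ⟂ᵢ[K, hK; μ] L := by
  refine CondIndepFun.symm ?_
  rw [condIndepFun_iff_condDistrib_prod_ae_eq_prodMkRight (by fun_prop) hL hK]
  have h1 := condDistrib_add_of_indepFun (hK.prodMk hL) he (hφ.comp measurable_fst) h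
  have h2 := condDistrib_add_of_indepFun hK he hφ (h.comp measurable_id measurable_fst)
  have h3 : (μ.map fun ω => (K ω, L ω)).map Prod.fst = μ.map K := by
    rw [Measure.map_map measurable_fst (hK.prodMk hL)]; rfl
  rw [← h3] at h2
  filter_upwards [h1, ae_of_ae_map measurable_fst.aemeasurable h2] with w hw1 hw2
  refine hw1.trans ?_
  rw [Kernel.prodMkRight_apply]
  refine Eq.trans ?_ hw2.symm
  rw [Kernel.map_apply _ (by fun_prop), Kernel.map_apply _ (by fun_prop), Kernel.prod_apply,
    Kernel.prod_apply, Kernel.id_apply, Kernel.id_apply, Kernel.const_apply, Kernel.const_apply,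
    Measure.dirac_prod, Measure.dirac_prod, Measure.map_map (by fun_prop) measurable_prodMk_left,
    Measure.map_map (by fun_prop) measurable_prodMk_left]
  rfl

/-- A law with independent residuals is Markov. -/
theorem isMarkov_of_iIndepFun_residual {G : Digraph (Fin p)} {P : Measure (Fin p → ℝ)}
    [IsProbabilityMeasure P] {f : (j : Fin p) → (parents G j → ℝ) → ℝ} (hG : IsDAG G)
    (hf : ∀ j, Measurable (f j)) (hind : iIndepFun (residual G f) P) : IsMarkov G P := by
  intro j
  have hsub : parents G j ⊆ nonDescendants G j := by
    intro i (hi : G.Adj i j)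
    refine ⟨?_, fun h => hG j (h.tail hi)⟩
    rintro rfl
    exact hG i (.single hi)
  -- A parent of a non-descendant of `j` that was `j` or a descendant of `j` would make its child a
  -- descendant too.
  have hclosed : ∀ i ∈ nonDescendants G j, parents G i ⊆ nonDescendants G j := by
    intro i hi a (ha : G.Adj a i)
    refine ⟨?_, fun h => hi.2 (h.tail ha)⟩
    rintro rfl
    exact hi.2 (.single ha)
  have hI := indep_residual_coordSigma hG hf hind hclosed (j := j) (fun h => h.1 rfl)
  have hI' : IndepFun (residual G f j) (fun x : Fin p → ℝ =>
      ((parents G j).domRestrict x, (nonDescendants G j).domRestrict x)) P := by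
    rw [IndepFun_iff_Indep]
    refine indep_of_indep_of_le_right hI ?_
    rw [← measurable_iff_comap_le]
    exact (measurable_coordSigma_domRestrict hsub).prodMk
      (measurable_coordSigma_domRestrict subset_rfl)
  have h := condIndepFun_add_of_indepFun (measurable_domRestrict _) (measurable_domRestrict _)
    (measurable_residual hf j) (hf j) hI'
  have h3 : (fun x : Fin p → ℝ => x j)
      = fun x => f j ((parents G j).domRestrict x) + residual G f j x := by
    funext x; simp [residual]
  rw [h3]
  exact h

/-! ### From the probability space of the model to the law -/

section Transfer

variable {Ω : Type*} [MeasurableSpace Ω] {μ : Measure Ω} {P : Measure (Fin p → ℝ)}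
  {G : Digraph (Fin p)} {f : (j : Fin p) → (parents G j → ℝ) → ℝ} {X ε : Ω → Fin p → ℝ}

theorem IsAdditiveNoiseModel.residual_ae_eq (h : IsAdditiveNoiseModel G f X ε μ) (j : Fin p) :
    (fun ω => residual G f j (X ω)) =ᵐ[μ] fun ω => ε ω j := by
  filter_upwards [h.structural_eq j] with ω hω
  simp [residual, hω]

/-- The residuals of `X` are a.s. the noise. Passing to `P` makes models on different probability
spaces comparable. -/
theorem IsAdditiveNoiseModel.iIndepFun_residual (h : IsAdditiveNoiseModel G f X ε μ)
    (hX : HasLaw X P μ) : iIndepFun (residual G f) P := by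
  have h1 : iIndepFun (fun j ω => residual G f j (X ω)) μ :=
    h.indep_noise.congr fun j => (h.residual_ae_eq j).symm
  rw [iIndepFun_iff_measure_inter_preimage_eq_mul] at h1 ⊢
  intro S s hs
  have hm : ∀ i ∈ S, MeasurableSet (residual G f i ⁻¹' s i) := fun i hi =>
    measurable_residual h.measurable_f i (hs i hi)
  rw [← hX.map_eq, Measure.map_apply_of_aemeasurable hX.aemeasurable (S.measurableSet_biInter hm)]
  convert h1 S hs using 1
  · simp only [preimage_iInter]; rfl
  · refine Finset.prod_congr rfl fun i hi => ?_
    rw [Measure.map_apply_of_aemeasurable hX.aemeasurable (hm i hi)]; rfl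

theorem IsAdditiveNoiseModel.integral_residual (h : IsAdditiveNoiseModel G f X ε μ)
    (hX : HasLaw X P μ) (j : Fin p) : ∫ x, residual G f j x ∂P = 0 := by
  rw [← hX.map_eq, integral_map hX.aemeasurable
    (measurable_residual h.measurable_f j).aestronglyMeasurable,
    integral_congr_ae (h.residual_ae_eq j), h.mean_noise j]

theorem IsAdditiveNoiseModel.integrable_residual [IsProbabilityMeasure μ]
    (h : IsAdditiveNoiseModel G f X ε μ) (hX : HasLaw X P μ) (j : Fin p) :
    Integrable (residual G f j) P := by
  rw [← hX.map_eq, integrable_map_measure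
    (measurable_residual h.measurable_f j).aestronglyMeasurable hX.aemeasurable]
  exact ((h.memLp_noise j).integrable (by norm_num)).congr (h.residual_ae_eq j).symm

end Transfer

/-! ### Regression functions and the intersection graph -/

/-- A function of the coordinates in `A` that agrees a.e. with one of the coordinates in `B` is
a.e. a function of the coordinates in `A ∩ B`. -/
theorem exists_ae_eq_of_domRestrict_ae_eq {A B C : Set (Fin p)} (hC : A ∩ B ⊆ C)
    {u : (A → ℝ) → ℝ} {v : (B → ℝ) → ℝ} (hu : Measurable u)
    (h : ∀ᵐ x : Fin p → ℝ, u (A.domRestrict x) = v (B.domRestrict x)) :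
    ∃ g : (C → ℝ) → ℝ, Measurable g ∧
      ∀ᵐ x : Fin p → ℝ, u (A.domRestrict x) = g (C.domRestrict x) := by
  classical
  have hmp := volume_preserving_piEquivPiSubtypeProd (fun _ : Fin p => ℝ) (· ∈ B)
  set T := MeasurableEquiv.piEquivPiSubtypeProd (fun _ : Fin p => ℝ) (· ∈ B) with hT
  have h1 : ∀ᵐ q : ({i // i ∈ B} → ℝ) × ({i // i ∉ B} → ℝ),
      u (A.domRestrict (T.symm q)) = v (B.domRestrict (T.symm q)) :=
    hmp.symm.quasiMeasurePreserving.ae h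
  -- The swap puts the coordinates outside `B` in the outer quantifier, so that one value `y` of
  -- them can be frozen.
  have h2 : ∀ᵐ q : ({i // i ∉ B} → ℝ) × ({i // i ∈ B} → ℝ),
      u (A.domRestrict (T.symm q.swap)) = v (B.domRestrict (T.symm q.swap)) :=
    Measure.measurePreserving_swap.quasiMeasurePreserving.ae h1
  obtain ⟨y, hy⟩ := (Measure.ae_ae_of_ae_prod h2).exists
  have h3 : ∀ᵐ x : Fin p → ℝ, u (A.domRestrict (T.symm ((T x).1, y)))
      = v (B.domRestrict (T.symm ((T x).1, y))) :=
    (Measure.quasiMeasurePreserving_fst.comp hmp.quasiMeasurePreserving).ae hy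
  -- Freezing the coordinates outside `B` at `y` leaves `v` unchanged, hence a.e. also `u`, which
  -- then sees only coordinates in `A ∩ B`.
  refine ⟨fun z => u fun i => if hi : i.1 ∈ B then z ⟨i, hC ⟨i.2, hi⟩⟩ else y ⟨i, hi⟩,
    hu.comp (measurable_pi_lambda _ fun i => ?_), ?_⟩
  · by_cases hi : i.1 ∈ B
    · simp only [hi, dite_true]; exact measurable_pi_apply _
    · simp only [hi, dite_false]; exact measurable_const
  · filter_upwards [h, h3] with x hx hx3
    have e1 : B.domRestrict (T.symm ((T x).1, y)) = B.domRestrict x := by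
      funext i
      simp [hT, MeasurableEquiv.piEquivPiSubtypeProd, Equiv.piEquivPiSubtypeProd]
    rw [hx, ← e1, ← hx3]
    congr 1

/-- Two additive noise models for one law with a common topological ordering have a.e. the same
regression functions. -/
theorem ae_eq_of_common_ordering {Ω Ω' : Type*} [MeasurableSpace Ω] [MeasurableSpace Ω']
    {μ : Measure Ω} [IsProbabilityMeasure μ] {μ' : Measure Ω'} [IsProbabilityMeasure μ']
    {P : Measure (Fin p → ℝ)} [IsProbabilityMeasure P] {G G' : Digraph (Fin p)}
    {f : (j : Fin p) → (parents G j → ℝ) → ℝ} {f' : (j : Fin p) → (parents G' j → ℝ) → ℝ}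
    {X ε : Ω → Fin p → ℝ} {X' ε' : Ω' → Fin p → ℝ}
    (hX : HasLaw X P μ) (hX' : HasLaw X' P μ')
    (hG : IsAdditiveNoiseModel G f X ε μ) (hG' : IsAdditiveNoiseModel G' f' X' ε' μ')
    {ρ : Equiv.Perm (Fin p)} (hρ : IsTopologicalOrdering G ρ) (hρ' : IsTopologicalOrdering G' ρ)
    (j : Fin p) :
    ∀ᵐ x ∂P, f j ((parents G j).domRestrict x) = f' j ((parents G' j).domRestrict x) := by
  have key : ∀ {H : Digraph (Fin p)}, IsDAG H → IsTopologicalOrdering H ρ →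
      ∀ {a b : Fin p}, H.Adj a b → ρ.symm a < ρ.symm b := by
    intro H hH hρH a b hab
    by_contra! hle
    rcases hle.eq_or_lt with heq | hlt
    · obtain rfl := ρ.symm.injective heq
      exact hH _ (.single hab)
    · exact hρH _ _ hlt (by simpa [IsAncestor] using Relation.TransGen.single hab)
  -- The predecessors of `j` are closed under parents in both graphs and contain both parent sets of
  -- `j`.
  set S : Set (Fin p) := {i | ρ.symm i < ρ.symm j} with hS
  have hjS : j ∉ S := fun h => lt_irrefl _ (show ρ.symm j < ρ.symm j from h)
  have I1 := indep_residual_coordSigma hG.isDAG hG.measurable_f (hG.iIndepFun_residual hX)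
    (A := S) (fun i hi a ha => (key hG.isDAG hρ ha).trans hi) hjS
  have I2 := indep_residual_coordSigma hG'.isDAG hG'.measurable_f (hG'.iIndepFun_residual hX')
    (A := S) (fun i hi a ha => (key hG'.isDAG hρ' ha).trans hi) hjS
  have c1 := condExp_indep_eq (measurable_residual hG.measurable_f j).comap_le
    (coordSigma_le S) (comap_measurable _).stronglyMeasurable I1
  have c2 := condExp_indep_eq (measurable_residual hG'.measurable_f j).comap_le
    (coordSigma_le S) (comap_measurable _).stronglyMeasurable I2
  have i1 := hG.integrable_residual hX j
  have i2 := hG'.integrable_residual hX' j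
  -- Both residuals have conditional mean zero given `S`, while their difference is a function of
  -- the coordinates in `S`, hence its own conditional mean.
  have hD : residual G' f' j - residual G f j = fun x =>
      f j ((parents G j).domRestrict x) - f' j ((parents G' j).domRestrict x) := by
    funext x; simp [residual]
  have hDm : Measurable[coordSigma S] (residual G' f' j - residual G f j) := by
    rw [hD]
    exact ((hG.measurable_f j).comp
      (measurable_coordSigma_domRestrict fun a ha => key hG.isDAG hρ ha)).sub
      ((hG'.measurable_f j).comp
        (measurable_coordSigma_domRestrict fun a ha => key hG'.isDAG hρ' ha))
  have c3 := condExp_of_stronglyMeasurable (coordSigma_le S) hDm.stronglyMeasurable (i2.sub i1)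
  have c4 := condExp_sub i2 i1 (coordSigma S)
  rw [c3] at c4
  filter_upwards [c1, c2, c4] with x h1 h2 h4
  rw [hG.integral_residual hX j] at h1
  rw [hG'.integral_residual hX' j] at h2
  rw [hD] at h4
  simp only [Pi.sub_apply, h1, h2, sub_zero] at h4
  exact sub_eq_zero.1 h4

theorem HasPositiveDensity.absolutelyContinuous {P : Measure (Fin p → ℝ)}
    (h : HasPositiveDensity P) : P ≪ volume ∧ volume ≪ P := by
  obtain ⟨d, hd, hpos, rfl⟩ := h
  exact ⟨withDensity_absolutelyContinuous _ _,
    withDensity_absolutelyContinuous' hd.aemeasurable (ae_of_all _ fun x => (hpos x).ne')⟩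

/-- Under a positive density, the law is Markov for the intersection of two additive noise model
graphs that share a topological ordering. -/
theorem isMarkov_inf {Ω Ω' : Type*} [MeasurableSpace Ω] [MeasurableSpace Ω']
    {μ : Measure Ω} [IsProbabilityMeasure μ] {μ' : Measure Ω'} [IsProbabilityMeasure μ']
    {P : Measure (Fin p → ℝ)} [IsProbabilityMeasure P] (hP : HasPositiveDensity P)
    {G G' : Digraph (Fin p)}
    {f : (j : Fin p) → (parents G j → ℝ) → ℝ} {f' : (j : Fin p) → (parents G' j → ℝ) → ℝ}
    {X ε : Ω → Fin p → ℝ} {X' ε' : Ω' → Fin p → ℝ}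
    (hX : HasLaw X P μ) (hX' : HasLaw X' P μ')
    (hG : IsAdditiveNoiseModel G f X ε μ) (hG' : IsAdditiveNoiseModel G' f' X' ε' μ')
    {ρ : Equiv.Perm (Fin p)} (hρ : IsTopologicalOrdering G ρ)
    (hρ' : IsTopologicalOrdering G' ρ) : IsMarkov (G ⊓ G') P := by
  have hex : ∀ j, ∃ g : (parents (G ⊓ G') j → ℝ) → ℝ, Measurable g ∧ ∀ᵐ x : Fin p → ℝ,
      f j ((parents G j).domRestrict x) = g ((parents (G ⊓ G') j).domRestrict x) := fun j =>
    exists_ae_eq_of_domRestrict_ae_eq (C := parents (G ⊓ G') j) (fun i hi => hi)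
      (hG.measurable_f j)
      (hP.absolutelyContinuous.2.ae_le (ae_eq_of_common_ordering hX hX' hG hG' hρ hρ' j))
  choose g hg hfg using hex
  -- Replacing `f` by `g` changes the residuals only on a null set, so they stay independent.
  refine isMarkov_of_iIndepFun_residual (hG.isDAG.mono inf_le_left) hg
    ((hG.iIndepFun_residual hX).congr fun j => ?_)
  filter_upwards [hP.absolutelyContinuous.1.ae_le (hfg j)] with x hx
  simp only [residual, hx]

/-- The optimal ordering for `G'` is weakly majorized by every ordering, in particular by the
optimal one for `G`; strictness for `G` then makes it topological for `G`. -/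
theorem MajorizationAssumption.exists_common_ordering {P : Measure (Fin p → ℝ)}
    {G G' : Digraph (Fin p)} (h : MajorizationAssumption G P) (h' : MajorizationAssumption G' P) :
    ∃ ρ, IsTopologicalOrdering G ρ ∧ IsTopologicalOrdering G' ρ := by
  obtain ⟨ρ, -, hρ⟩ := h
  obtain ⟨ρ', ht', hρ'⟩ := h'
  exact ⟨ρ', by_contra fun hn => (hρ ρ').2 hn (hρ' ρ).1, ht'⟩

end MajorizedANM

theorem mainTheorem1 {p : ℕ}
    {Ω Ω' : Type*} [MeasurableSpace Ω] [MeasurableSpace Ω']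
    (μ : Measure Ω) [IsProbabilityMeasure μ] (μ' : Measure Ω') [IsProbabilityMeasure μ']
    (P : Measure (Fin p → ℝ)) [IsProbabilityMeasure P]
    (hP : MajorizedANM.HasPositiveDensity P)
    (G G' : Digraph (Fin p))
    (f : (j : Fin p) → (MajorizedANM.parents G j → ℝ) → ℝ)
    (f' : (j : Fin p) → (MajorizedANM.parents G' j → ℝ) → ℝ)
    (X ε : Ω → Fin p → ℝ) (X' ε' : Ω' → Fin p → ℝ)
    (hX : HasLaw X P μ) (hX' : HasLaw X' P μ')
    (hG : MajorizedANM.IsAdditiveNoiseModel G f X ε μ)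
    (hG' : MajorizedANM.IsAdditiveNoiseModel G' f' X' ε' μ')
    (hmin : MajorizedANM.IsCausallyMinimal G P)
    (hmin' : MajorizedANM.IsCausallyMinimal G' P)
    (hmaj : MajorizedANM.MajorizationAssumption G P)
    (hmaj' : MajorizedANM.MajorizationAssumption G' P) :
    G = G' := by
  obtain ⟨ρ, hρ, hρ'⟩ := hmaj.exists_common_ordering hmaj'
  have hM := MajorizedANM.isMarkov_inf hP hX hX' hG hG' hρ hρ'
  have h1 : G ⊓ G' = G := inf_le_left.eq_of_not_lt fun hlt => hmin _ hlt hM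
  have h2 : G ⊓ G' = G' := inf_le_right.eq_of_not_lt fun hlt => hmin' _ hlt hM
  exact h1.symm.trans h2
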